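/- There is an absolute constant $C\in\mathbb R$ such that the following holds. Let $a,b,c\in\mathbb Z$ be such that $\Delta:=\sqrt{b^2-4ac}$ is a positive integer, let $n,x_0,y_0\in\mathbb R$ with $n\neq 0$, and let $h\subset\mathbb R^2$ be the hyperbola $$a(x-x_0)^2+b(x-x_0)(y-y_0)+c(y-y_0)^2=n$$ (its asymptotes then have rational, possibly infinite, slopes). Let $H$ be the closure of one of the convex connected components of $\mathbb R^2\setminus h$, and let $V$ be the set of vertices (extreme points) of $\operatorname{conv}(H\cap\mathbb Z^2)$. Then $V$ is finite and $$2\left(\frac{|n|}{\Delta}\right)^{1/3}-2\;\le\;|V|\;\le\;C\,m^{1/3}\,(\log_2 m+2),\qquad\text{where } m:=\max\left\{2\Delta,\frac{|n|}{\Delta}\right\}.$$ -/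

import Mathlib

/-- The plane curve `a (x - x₀)² + b (x - x₀)(y - y₀) + c (y - y₀)² = n`. It is a hyperbola
exactly when `b² - 4ac > 0` and `n ≠ 0`. -/
def hyperbola (a b c n x₀ y₀ : ℝ) : Set (ℝ × ℝ) :=
  {p | a * (p.1 - x₀) ^ 2 + b * (p.1 - x₀) * (p.2 - y₀) + c * (p.2 - y₀) ^ 2 = n}

/-- `K` is a connected component of the subset `U` of the plane. -/
def IsComponentOf (K U : Set (ℝ × ℝ)) : Prop :=
  ∃ p ∈ U, K = connectedComponentIn U p

/-- The integer lattice `ℤ²` in the plane. -/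
def integerLattice : Set (ℝ × ℝ) :=
  Set.range fun z : ℤ × ℤ => ((z.1 : ℝ), (z.2 : ℝ))

/-- The vertices (extreme points) of the convex hull of the integer points of `H`. -/
def integerHullVertices (H : Set (ℝ × ℝ)) : Set (ℝ × ℝ) :=
  Set.extremePoints ℝ (convexHull ℝ (H ∩ integerLattice))

/-! Since the discriminant is a square, the quadratic form factors over the integers as `g (p x + q
y) (r x + s y)` with primitive factors and `g D = Δ`, where `D = |p s - q r|`. Let `Y`, `W` be the
affine forms vanishing on the asymptotes. Up to signs, the hyperbola is `Y W = R` with `R = |n| /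
g`, so `R / D = |n| / Δ`, and `H` is the region `Y, W > 0`, `Y W ≥ R`. In the coordinates `(Y, W)`
the integer points form a translated lattice of covolume `D`; they lie on levels of `Y` with unit
spacing, and within a level their `W` values are spaced by `D`.

Lower bound (`exists_vertex_of_level`): on a level with `D Y³ ≤ R`, the graph of `R / Y` bends so
sharply that rounding up by less than `D` cannot destroy convexity, so the lowest integer point of
the level is a vertex. This gives at least `μ - 1` vertices near each asymptote, with `μ = (R /
D)^(1/3)`. When `μ > 1` the two groups are disjoint, because `Y, W ≤ μ` would force `Y W ≤ μ² < R`.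

Upper bound: by Dirichlet approximation, an integer point with `Y W > 4 max(R, D)` is the midpoint
of two others in the region, so it is no vertex (`vertex_mul_le`). Hence the hull edges within a
dyadic block `B ≤ Y < 2B` have total extent at most `B` in `Y` and `4 max(R, D) / B` in `W`, while
their pairwise cross products are at least `D` (`abs_det_le_edge_cross`). Such a convex chain has
`O((max(R, D) / D)^(1/3))` edges (`chain_bound`). All but two vertices have `Y, W ≥ 1`, so `O(log
m)` blocks suffice. -/

/-! ### Counting separated points and convex chains -/

/-- A finite family of points of `[0, 1]` with pairwise distances at least `δ` has at most
`1 / δ + 1` members. -/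
theorem card_le_of_separated {ι : Type*} (s : Finset ι) (φ : ι → ℝ) {δ : ℝ} (hδ : 0 < δ)
    (h0 : ∀ i ∈ s, 0 ≤ φ i) (h1 : ∀ i ∈ s, φ i ≤ 1)
    (hsep : ∀ i ∈ s, ∀ j ∈ s, i ≠ j → δ ≤ |φ i - φ j|) :
    (s.card : ℝ) ≤ 1 / δ + 1 := by
  have hcard : s.card ≤ (Finset.range (⌊1 / δ⌋₊ + 1)).card := by
    refine Finset.card_le_card_of_injOn (fun i => ⌊φ i / δ⌋₊) ?_ ?_
    · intro i hi
      have hle : φ i / δ ≤ 1 / δ := by gcongr; exact h1 i hi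
      simpa [Nat.lt_succ_iff] using Nat.floor_le_floor hle
    · intro i hi j hj hij
      by_contra hne
      have hs := hsep i hi j hj hne
      have hij' : ⌊φ i / δ⌋₊ = ⌊φ j / δ⌋₊ := hij
      have hi1 := Nat.floor_le (div_nonneg (h0 i hi) hδ.le)
      have hi2 := Nat.lt_floor_add_one (φ i / δ)
      have hj1 := Nat.floor_le (div_nonneg (h0 j hj) hδ.le)
      have hj2 := Nat.lt_floor_add_one (φ j / δ)
      rw [hij'] at hi1 hi2
      have hlt : |φ i / δ - φ j / δ| < 1 := by
        rw [abs_lt]; constructor <;> linarith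
      rw [← sub_div, abs_div, abs_of_pos hδ, div_lt_one hδ] at hlt
      linarith
  rw [Finset.card_range] at hcard
  have hc : (s.card : ℝ) ≤ ((⌊1 / δ⌋₊ + 1 : ℕ) : ℝ) := by exact_mod_cast hcard
  push_cast at hc
  have := Nat.floor_le (a := 1 / δ) (by positivity)
  linarith

/-- Markov's inequality for finite sums. -/
theorem card_filter_lt_le {k : ℕ} {a : ℕ → ℝ} {A κ : ℝ} (hA : 0 < A) (hκ : 0 < κ)
    (ha : ∀ i < k, 0 < a i) (hs : ∑ i ∈ Finset.range k, a i ≤ A) :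
    (((Finset.range k).filter fun i => A / κ < a i).card : ℝ) ≤ κ := by
  have h1 : ((Finset.range k).filter fun i => A / κ < a i).card • (A / κ) ≤
      ∑ i ∈ (Finset.range k).filter fun i => A / κ < a i, a i :=
    Finset.card_nsmul_le_sum _ _ _ fun i hi => (Finset.mem_filter.1 hi).2.le
  have h2 : ∑ i ∈ (Finset.range k).filter fun i => A / κ < a i, a i ≤
      ∑ i ∈ Finset.range k, a i :=
    Finset.sum_le_sum_of_subset_of_nonneg (Finset.filter_subset _ _)
      fun i hi _ => (ha i (Finset.mem_range.1 hi)).le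
  rw [nsmul_eq_mul] at h1
  have h3 := h1.trans (h2.trans hs)
  rw [← mul_div_assoc, div_le_iff₀ hκ, mul_comm] at h3
  exact le_of_mul_le_mul_left h3 hA

/-- A family of vectors in the open positive quadrant, with bounded coordinate sums and pairwise
cross products at least `1`, is small. -/
theorem chain_bound {k : ℕ} {a b : ℕ → ℝ} {A B κ : ℝ} (hA : 0 < A) (hB : 0 < B) (hκ : 0 < κ)
    (ha : ∀ i < k, 0 < a i) (hb : ∀ i < k, 0 < b i)
    (hsa : ∑ i ∈ Finset.range k, a i ≤ A) (hsb : ∑ i ∈ Finset.range k, b i ≤ B)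
    (hcross : ∀ i j, i < j → j < k → 1 ≤ a i * b j - a j * b i) :
    (k : ℝ) ≤ 2 * κ + 4 * (A * B) / κ ^ 2 + 1 := by
  classical
  have hα : 0 < A / κ := by positivity
  have hβ : 0 < B / κ := by positivity
  set α := A / κ with hαd
  set β := B / κ with hβd
  set s := (Finset.range k).filter fun i => a i ≤ α ∧ b i ≤ β with hs
  -- By Markov, all but at most `2κ` of the vectors lie in the box `a ≤ α`, `b ≤ β`.
  have hsub : Finset.range k ⊆ ((Finset.range k).filter fun i => α < a i) ∪
      ((Finset.range k).filter fun i => β < b i) ∪ s := by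
    intro i hi
    simp only [hs, Finset.mem_union, Finset.mem_filter]
    by_cases h1 : α < a i
    · exact Or.inl (Or.inl ⟨hi, h1⟩)
    by_cases h2 : β < b i
    · exact Or.inl (Or.inr ⟨hi, h2⟩)
    exact Or.inr ⟨hi, not_lt.1 h1, not_lt.1 h2⟩
  have hk : k ≤ ((Finset.range k).filter fun i => α < a i).card +
      ((Finset.range k).filter fun i => β < b i).card + s.card := by
    calc k = (Finset.range k).card := (Finset.card_range k).symm
      _ ≤ _ := Finset.card_le_card hsub
      _ ≤ _ := Finset.card_union_le _ _
      _ ≤ _ := by gcongr; exact Finset.card_union_le _ _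
  have hk' : (k : ℝ) ≤ (((Finset.range k).filter fun i => α < a i).card : ℝ) +
      (((Finset.range k).filter fun i => β < b i).card : ℝ) + (s.card : ℝ) := by
    exact_mod_cast hk
  have h1 := card_filter_lt_le hA hκ ha hsa
  have h2 := card_filter_lt_le hB hκ hb hsb
  have hmem : ∀ i ∈ s, 0 < a i ∧ 0 < b i ∧ a i ≤ α ∧ b i ≤ β ∧ i < k := by
    intro i hi
    obtain ⟨h, h3, h4⟩ := Finset.mem_filter.1 hi
    have h := Finset.mem_range.1 h
    exact ⟨ha i h, hb i h, h3, h4, h⟩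
  -- After rescaling to `(a / α, b / β)`, the direction of a vector is recorded by its first
  -- coordinate once the coordinate sum is normalized to 1. Two such values differ by the rescaled
  -- cross product, at least `1 / (αβ)`, divided by the two coordinate sums, each at most 2.
  have key : ∀ i ∈ s, ∀ j ∈ s, i < j →
      1 / (4 * (α * β)) ≤ a i * β / (a i * β + b i * α) - a j * β / (a j * β + b j * α) := by
    intro i hi j hj hij
    obtain ⟨a1, b1, a2, b2, -⟩ := hmem i hi
    obtain ⟨a3, b3, a4, b4, hjk⟩ := hmem j hj
    have hc := hcross i j hij hjk
    have hi0 : 0 < a i * β + b i * α := by positivity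
    have hj0 : 0 < a j * β + b j * α := by positivity
    have e : a i * β / (a i * β + b i * α) - a j * β / (a j * β + b j * α) =
        (a i * b j - a j * b i) * (α * β) / ((a i * β + b i * α) * (a j * β + b j * α)) := by
      field_simp; ring
    rw [e, div_le_div_iff₀ (by positivity) (by positivity)]
    have hi1 : a i * β + b i * α ≤ 2 * (α * β) := by nlinarith
    have hj1 : a j * β + b j * α ≤ 2 * (α * β) := by nlinarith
    have hαβ : 0 < α * β := by positivity
    calc 1 * ((a i * β + b i * α) * (a j * β + b j * α))
        ≤ 1 * ((2 * (α * β)) * (2 * (α * β))) := by gcongr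
      _ = 1 * ((α * β) * (4 * (α * β))) := by ring
      _ ≤ (a i * b j - a j * b i) * ((α * β) * (4 * (α * β))) := by gcongr
      _ = _ := by ring
  have h3 := card_le_of_separated s (fun i => a i * β / (a i * β + b i * α))
    (δ := 1 / (4 * (α * β))) (by positivity)
    (fun i hi => by
      obtain ⟨a1, b1, -⟩ := hmem i hi
      positivity)
    (fun i hi => by
      obtain ⟨a1, b1, -⟩ := hmem i hi
      rw [div_le_one (by positivity)]
      have : 0 < b i * α := by positivity
      linarith)
    (fun i hi j hj hij => by
      rcases lt_or_gt_of_ne hij with h | h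
      · exact (key i hi j hj h).trans (le_abs_self _)
      · rw [abs_sub_comm]
        exact (key j hj i hi h).trans (le_abs_self _))
  have e : 1 / (1 / (4 * (α * β))) = 4 * (A * B) / κ ^ 2 := by
    rw [hαd, hβd]; field_simp
  rw [e] at h3
  linarith

/-- The elements of a finite subset of a linear order, listed increasingly. -/
theorem exists_strictMonoOn_enumeration {α : Type*} [LinearOrder α] (s : Finset α) {k : ℕ}
    (hk : s.card = k + 1) :
    ∃ g : ℕ → α, (∀ i, g i ∈ s) ∧ ∀ i j, i < j → j ≤ k → g i < g j := by
  refine ⟨fun i => s.orderEmbOfFin hk ⟨min i k, by omega⟩, fun i => s.orderEmbOfFin_mem hk _, ?_⟩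
  intro i j hij hj
  apply (s.orderEmbOfFin hk).strictMono
  rw [Fin.mk_lt_mk]
  omega

/-! ### Integral affine forms and the lattice -/

/-- The affine form `p x + q y - η`. -/
def affineForm (p q : ℤ) (η : ℝ) (v : ℝ × ℝ) : ℝ := p * v.1 + q * v.2 - η

/-- The region bounded by one branch of a hyperbola whose asymptotes are the zero lines of two
integral affine forms. -/
def branchRegion (p q r s : ℤ) (η ω R : ℝ) : Set (ℝ × ℝ) :=
  {v | 0 < affineForm p q η v ∧ 0 < affineForm r s ω v ∧
    R ≤ affineForm p q η v * affineForm r s ω v}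

/-- The symmetry between the asymptotes: it transfers results about levels of the first form to the
second. -/
theorem branchRegion_swap (p q r s : ℤ) (η ω R : ℝ) :
    branchRegion r s p q ω η R = branchRegion p q r s η ω R := by
  ext v
  simp only [branchRegion, Set.mem_ofPred_eq, mul_comm (affineForm r s ω v)]
  tauto

theorem affineForm_add_smul (p q : ℤ) (η : ℝ) (v w : ℝ × ℝ) (t : ℝ) :
    affineForm p q η (v + t • w) = affineForm p q η v + t * affineForm p q 0 w := by
  simp only [affineForm, Prod.fst_add, Prod.snd_add, Prod.smul_fst, Prod.smul_snd, smul_eq_mul]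
  ring

theorem affineForm_add (p q : ℤ) (η : ℝ) (v w : ℝ × ℝ) :
    affineForm p q η (v + w) = affineForm p q η v + affineForm p q 0 w := by
  simp only [affineForm, Prod.fst_add, Prod.snd_add]; ring

theorem affineForm_sub (p q : ℤ) (η : ℝ) (v w : ℝ × ℝ) :
    affineForm p q η (v - w) = affineForm p q η v - affineForm p q 0 w := by
  simp only [affineForm, Prod.fst_sub, Prod.snd_sub]; ring

theorem affineForm_zero_sub (p q : ℤ) (η : ℝ) (v w : ℝ × ℝ) :
    affineForm p q 0 (v - w) = affineForm p q η v - affineForm p q η w := by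
  simp only [affineForm, Prod.fst_sub, Prod.snd_sub]; ring

theorem affineForm_combo (p q : ℤ) (η : ℝ) (v w : ℝ × ℝ) {a b : ℝ} (hab : a + b = 1) :
    affineForm p q η (a • v + b • w) = a * affineForm p q η v + b * affineForm p q η w := by
  simp only [affineForm, Prod.fst_add, Prod.snd_add, Prod.smul_fst, Prod.smul_snd, smul_eq_mul]
  linear_combination η * hab

theorem add_mem_integerLattice {v w : ℝ × ℝ} (hv : v ∈ integerLattice)
    (hw : w ∈ integerLattice) : v + w ∈ integerLattice := by
  obtain ⟨⟨x, y⟩, rfl⟩ := hv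
  obtain ⟨⟨x', y'⟩, rfl⟩ := hw
  exact ⟨(x + x', y + y'), by simp⟩

theorem sub_mem_integerLattice {v w : ℝ × ℝ} (hv : v ∈ integerLattice)
    (hw : w ∈ integerLattice) : v - w ∈ integerLattice := by
  obtain ⟨⟨x, y⟩, rfl⟩ := hv
  obtain ⟨⟨x', y'⟩, rfl⟩ := hw
  exact ⟨(x - x', y - y'), by simp⟩

theorem affineForm_zero_eq_intCast (p q : ℤ) {v : ℝ × ℝ} (hv : v ∈ integerLattice) :
    ∃ k : ℤ, affineForm p q 0 v = k := by
  obtain ⟨⟨x, y⟩, rfl⟩ := hv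
  exact ⟨p * x + q * y, by simp [affineForm]⟩

theorem affineForm_sub_eq_intCast (p q : ℤ) (η : ℝ) {v w : ℝ × ℝ} (hv : v ∈ integerLattice)
    (hw : w ∈ integerLattice) : ∃ k : ℤ, affineForm p q η v - affineForm p q η w = k := by
  rw [← affineForm_zero_sub]
  exact affineForm_zero_eq_intCast p q (sub_mem_integerLattice hv hw)

/-- Two independent affine forms separate points. -/
theorem eq_of_affineForm_eq {p q r s : ℤ} (hd : p * s - q * r ≠ 0) {η ω : ℝ} {v w : ℝ × ℝ}
    (h1 : affineForm p q η v = affineForm p q η w)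
    (h2 : affineForm r s ω v = affineForm r s ω w) : v = w := by
  have hd' : (p : ℝ) * s - q * r ≠ 0 := by exact_mod_cast hd
  simp only [affineForm] at h1 h2
  ext
  · apply mul_left_cancel₀ hd'
    linear_combination (s : ℝ) * h1 - (q : ℝ) * h2
  · apply mul_left_cancel₀ hd'
    linear_combination (p : ℝ) * h2 - (r : ℝ) * h1

/-- Cross products of lattice vectors, measured in the coordinates given by two integral forms,
are multiples of the determinant of the forms. -/
theorem abs_det_le_cross {p q r s : ℤ} {v w : ℝ × ℝ} (hv : v ∈ integerLattice)
    (hw : w ∈ integerLattice)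
    (h : 0 < affineForm r s 0 v * affineForm p q 0 w - affineForm r s 0 w * affineForm p q 0 v) :
    ((|p * s - q * r| : ℤ) : ℝ) ≤
      affineForm r s 0 v * affineForm p q 0 w - affineForm r s 0 w * affineForm p q 0 v := by
  obtain ⟨⟨x, y⟩, rfl⟩ := hv
  obtain ⟨⟨x', y'⟩, rfl⟩ := hw
  -- The two linear forms are the rows of an integer matrix, which multiplies cross products by its
  -- determinant, up to the sign fixed by the order of the rows.
  have e : affineForm r s 0 ((x : ℝ), (y : ℝ)) * affineForm p q 0 ((x' : ℝ), (y' : ℝ)) -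
      affineForm r s 0 ((x' : ℝ), (y' : ℝ)) * affineForm p q 0 ((x : ℝ), (y : ℝ)) =
      (((p * s - q * r) * (y * x' - x * y') : ℤ) : ℝ) := by
    simp only [affineForm]; push_cast; ring
  simp only [e] at h ⊢
  have h' : 0 < (p * s - q * r) * (y * x' - x * y') := by exact_mod_cast h
  exact_mod_cast Int.le_of_dvd h' ((abs_dvd _ _).2 (dvd_mul_right _ _))

/-- A lattice vector along the zero line of the first form. -/
theorem exists_kernel_vector (p q r s : ℤ) :
    ∃ w ∈ integerLattice, affineForm p q 0 w = 0 ∧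
      affineForm r s 0 w = ((|p * s - q * r| : ℤ) : ℝ) := by
  rcases le_total 0 (p * s - q * r) with h | h
  · refine ⟨_, ⟨(-q, p), rfl⟩, ?_, ?_⟩
    · simp only [affineForm]; push_cast; ring
    · rw [abs_of_nonneg h]; simp only [affineForm]; push_cast; ring
  · refine ⟨_, ⟨(q, -p), rfl⟩, ?_, ?_⟩
    · simp only [affineForm]; push_cast; ring
    · rw [abs_of_nonpos h]; simp only [affineForm]; push_cast; ring

theorem zsmul_mem_integerLattice {v : ℝ × ℝ} (hv : v ∈ integerLattice) (k : ℤ) :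
    (k : ℝ) • v ∈ integerLattice := by
  obtain ⟨⟨x, y⟩, rfl⟩ := hv
  exact ⟨(k * x, k * y), by simp⟩

/-! ### Vertices of integer hulls -/

theorem mem_of_mem_integerHullVertices {H : Set (ℝ × ℝ)} {v : ℝ × ℝ}
    (hv : v ∈ integerHullVertices H) : v ∈ H ∧ v ∈ integerLattice := by
  have h : v ∈ H ∩ integerLattice := extremePoints_convexHull_subset hv
  exact h

/-- A vertex is not the midpoint of two other integer points. -/
theorem eq_zero_of_add_mem_of_sub_mem {H : Set (ℝ × ℝ)} {v e : ℝ × ℝ}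
    (hv : v ∈ integerHullVertices H) (he : e ∈ integerLattice) (h1 : v + e ∈ H) (h2 : v - e ∈ H) :
    e = 0 := by
  have hl := (mem_of_mem_integerHullVertices hv).2
  have hm : v ∈ openSegment ℝ (v + e) (v - e) :=
    ⟨1 / 2, 1 / 2, by norm_num, by norm_num, by norm_num, by module⟩
  have := hv.2 (subset_convexHull ℝ _ ⟨h1, add_mem_integerLattice hl he⟩)
    (subset_convexHull ℝ _ ⟨h2, sub_mem_integerLattice hl he⟩) hm
  simpa using this

/-- A strict minimizer of an affine form among the points of `S` is a vertex of its hull. -/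
theorem mem_extremePoints_convexHull_of_strict_min {S : Set (ℝ × ℝ)} {v : ℝ × ℝ} (hv : v ∈ S)
    (f : ℝ × ℝ →ₗ[ℝ] ℝ) (h : ∀ w ∈ S, w ≠ v → f v < f w) :
    v ∈ Set.extremePoints ℝ (convexHull ℝ S) := by
  -- An open half-plane together with one point of its boundary line is convex, and that point is
  -- extreme in it.
  have hconv : Convex ℝ {w | w = v ∨ f v < f w} := by
    rw [convex_iff_forall_pos]
    intro x hx y hy a b ha hb hab
    have e : f (a • x + b • y) = a * f x + b * f y := by simp
    have e' : f v = a * f v + b * f v := by rw [← add_mul, hab, one_mul]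
    rcases hx with rfl | hx
    · rcases hy with rfl | hy
      · left; rw [← add_smul, hab, one_smul]
      · right; rw [e]; nlinarith
    · right; rw [e]
      rcases hy with rfl | hy <;> nlinarith
  have hsub : convexHull ℝ S ⊆ {w | w = v ∨ f v < f w} := by
    refine convexHull_min (fun w hw => ?_) hconv
    by_cases hwv : w = v
    · exact Or.inl hwv
    · exact Or.inr (h w hw hwv)
  refine ⟨subset_convexHull ℝ S hv, ?_⟩
  rintro x hx y hy ⟨a, b, ha, hb, hab, hxy⟩
  rcases hsub hx with rfl | hx'
  · rfl
  exfalso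
  have e : f v = a * f x + b * f y := by rw [← hxy]; simp
  have e' : f v = a * f v + b * f v := by rw [← add_mul, hab, one_mul]
  rcases hsub hy with rfl | hy' <;> nlinarith

section Vertices

variable {p q r s : ℤ} {η ω R : ℝ}

/-- The quadrant spanned by the asymptotic directions consists of recession directions, since both
factors only grow. -/
theorem add_mem_branchRegion {v e : ℝ × ℝ} (hv : v ∈ branchRegion p q r s η ω R)
    (h1 : 0 ≤ affineForm p q 0 e) (h2 : 0 ≤ affineForm r s 0 e) :
    v + e ∈ branchRegion p q r s η ω R := by
  obtain ⟨a, b, c⟩ := hv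
  refine ⟨?_, ?_, ?_⟩ <;> simp only [affineForm_add]
  · linarith
  · linarith
  · nlinarith [mul_nonneg h1 h2, mul_nonneg h1 b.le, mul_nonneg a.le h2]

/-- Distinct vertices are incomparable in the coordinates given by the asymptotes. -/
theorem vertex_eq_of_le {v w : ℝ × ℝ}
    (hv : v ∈ integerHullVertices (branchRegion p q r s η ω R))
    (hw : w ∈ integerHullVertices (branchRegion p q r s η ω R))
    (h1 : affineForm p q η v ≤ affineForm p q η w) (h2 : affineForm r s ω v ≤ affineForm r s ω w) :
    v = w := by
  have hv' := mem_of_mem_integerHullVertices hv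
  have hw' := mem_of_mem_integerHullVertices hw
  -- If `w` dominates `v`, the reflection `2w - v` is again in the region, and `w` is the midpoint
  -- of it and `v`.
  have := eq_zero_of_add_mem_of_sub_mem hw (sub_mem_integerLattice hw'.2 hv'.2)
    (add_mem_branchRegion hw'.1 (by rw [affineForm_zero_sub p q η]; linarith)
      (by rw [affineForm_zero_sub r s ω]; linarith)) (by simpa using hv'.1)
  exact (sub_eq_zero.1 this).symm

theorem vertex_eq_of_level_eq {v w : ℝ × ℝ}
    (hv : v ∈ integerHullVertices (branchRegion p q r s η ω R))
    (hw : w ∈ integerHullVertices (branchRegion p q r s η ω R))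
    (h : affineForm p q η v = affineForm p q η w) : v = w := by
  rcases le_total (affineForm r s ω v) (affineForm r s ω w) with h' | h'
  · exact vertex_eq_of_le hv hw h.le h'
  · exact (vertex_eq_of_le hw hv h.ge h').symm

/-- The vertices form a descending staircase, so ordering them by one coordinate orders them along
the boundary. -/
theorem vertex_strictAnti {v w : ℝ × ℝ}
    (hv : v ∈ integerHullVertices (branchRegion p q r s η ω R))
    (hw : w ∈ integerHullVertices (branchRegion p q r s η ω R))
    (h : affineForm p q η v < affineForm p q η w) : affineForm r s ω w < affineForm r s ω v := by
  by_contra h'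
  have := vertex_eq_of_le hv hw h.le (not_lt.1 h')
  rw [this] at h
  exact lt_irrefl _ h

/-- At most one vertex has level less than `1`. -/
theorem vertex_eq_of_level_lt_one {v w : ℝ × ℝ}
    (hv : v ∈ integerHullVertices (branchRegion p q r s η ω R))
    (hw : w ∈ integerHullVertices (branchRegion p q r s η ω R))
    (h1 : affineForm p q η v < 1) (h2 : affineForm p q η w < 1) : v = w := by
  have hv' := mem_of_mem_integerHullVertices hv
  have hw' := mem_of_mem_integerHullVertices hw
  have a := hv'.1.1
  have b := hw'.1.1
  -- Both levels lie in `(0, 1)` and differ by an integer, so they agree.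
  obtain ⟨k, hk⟩ := affineForm_sub_eq_intCast p q η hv'.2 hw'.2
  have k1 : (k : ℝ) < 1 := by linarith
  have k2 : (-1 : ℝ) < k := by linarith
  have k1' : k < 1 := by exact_mod_cast k1
  have k2' : -1 < k := by exact_mod_cast k2
  have hk0 : k = 0 := by omega
  rw [hk0] at hk
  refine vertex_eq_of_level_eq hv hw ?_
  push_cast at hk
  linarith

/-- Every level at height at most the cube root of `R / |det|` contains a vertex. -/
theorem exists_vertex_of_level (hpq : IsCoprime p q) (hd : p * s - q * r ≠ 0) (t : ℤ)
    (ht : 0 < (t : ℝ) - η) (hR : 0 < R)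
    (htR : ((|p * s - q * r| : ℤ) : ℝ) * ((t : ℝ) - η) ^ 3 ≤ R) :
    ∃ v ∈ integerHullVertices (branchRegion p q r s η ω R), affineForm p q η v = t - η := by
  obtain ⟨e, he, he1, he2⟩ := exists_kernel_vector p q r s
  have hD : 0 < ((|p * s - q * r| : ℤ) : ℝ) := by exact_mod_cast abs_pos.2 hd
  set D := ((|p * s - q * r| : ℤ) : ℝ) with hDd
  set Y := (t : ℝ) - η with hY
  obtain ⟨x, y, hxy⟩ := hpq
  set z : ℝ × ℝ := (((t * x : ℤ) : ℝ), ((t * y : ℤ) : ℝ)) with hz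
  have hzl : z ∈ integerLattice := ⟨(t * x, t * y), rfl⟩
  have hxy' : (x : ℝ) * p + y * q = 1 := by exact_mod_cast hxy
  have hzY : affineForm p q η z = Y := by
    simp only [affineForm, hz, hY]; push_cast; linear_combination (t : ℝ) * hxy'
  -- A Bézout point `z` on the level is slid along the asymptotic direction until its second
  -- coordinate falls in `[R / Y, R / Y + D)`, which gives the lowest integer point of the level
  -- inside the region.
  obtain ⟨m, hm, -⟩ := existsUnique_add_zsmul_mem_Ico hD (affineForm r s ω z) (R / Y)
  set v := z + (m : ℝ) • e with hv
  have hvl : v ∈ integerLattice := add_mem_integerLattice hzl (zsmul_mem_integerLattice he m)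
  have hvY : affineForm p q η v = Y := by rw [hv, affineForm_add_smul, he1, hzY]; ring
  have hvW : affineForm r s ω v = affineForm r s ω z + m • D := by
    rw [hv, affineForm_add_smul, he2, zsmul_eq_mul]
  rw [← hvW] at hm
  obtain ⟨hm1, hm2⟩ := hm
  have hvT : v ∈ branchRegion p q r s η ω R := by
    refine ⟨by rw [hvY]; exact ht, lt_of_lt_of_le (by positivity) hm1, ?_⟩
    rw [hvY]
    rwa [div_le_iff₀ ht, mul_comm] at hm1
  refine ⟨v, ?_, hvY⟩
  -- `W + c Y` is the supporting functional. The value `c` is the drop of `R / Y` to the next level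
  -- plus the largest possible rounding error `D`, which handles all higher levels. That it also
  -- works for lower levels is where `D Y³ ≤ R` enters.
  let c : ℝ := R / (Y * (Y + 1)) + D
  let f : ℝ × ℝ →ₗ[ℝ] ℝ :=
    ((r : ℝ) + c * p) • LinearMap.fst ℝ ℝ ℝ + ((s : ℝ) + c * q) • LinearMap.snd ℝ ℝ ℝ
  have hf : ∀ w, f w = affineForm r s ω w + c * affineForm p q η w + ω + c * η := by
    intro w
    simp only [f, affineForm, LinearMap.add_apply, LinearMap.smul_apply, LinearMap.fst_apply,
      LinearMap.snd_apply, smul_eq_mul]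
    ring
  refine mem_extremePoints_convexHull_of_strict_min ⟨hvT, hvl⟩ f ?_
  rintro w ⟨⟨w1, w2, w3⟩, hwl⟩ hwv
  suffices h : affineForm r s ω v + c * affineForm p q η v <
      affineForm r s ω w + c * affineForm p q η w by
    rw [hf, hf]; linarith
  obtain ⟨k, hk⟩ := affineForm_sub_eq_intCast p q η hwl hvl
  rw [hvY] at hk ⊢
  have hwY : affineForm p q η w = Y + k := by linarith
  rw [hwY] at w1 w3 ⊢
  have hW : R / (Y + k) ≤ affineForm r s ω w := by
    rw [div_le_iff₀ w1]; linarith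
  have hcpos : 0 < c := by positivity
  rcases lt_trichotomy k 0 with hk0 | rfl | hk0
  · have hk1 : (1 : ℝ) ≤ -k := by
      have : 1 ≤ -k := by omega
      exact_mod_cast this
    set a : ℝ := -k with ha
    have hka : (k : ℝ) = -a := by rw [ha]; ring
    rw [hka] at hW w1 ⊢
    -- Since `a ≥ 1`, the left side is at most `D Y (Y² - 1) < D Y³ ≤ R`.
    have key : D * Y * (Y + -a) * (Y + 1) ≤ R * a := by
      calc D * Y * (Y + -a) * (Y + 1) ≤ D * Y * (Y - 1) * (Y + 1) := by
            gcongr; linarith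
        _ ≤ D * Y ^ 3 := by nlinarith [mul_pos hD ht]
        _ ≤ R := htR
        _ ≤ R * a := by nlinarith
    have e1 : R / (Y + -a) - R / Y - D - c * a =
        (1 + a) * (R * a - D * Y * (Y + -a) * (Y + 1)) / (Y * (Y + -a) * (Y + 1)) := by
      simp only [c]
      have : Y + -a ≠ 0 := w1.ne'
      field_simp
      ring
    have e2 : 0 ≤ R / (Y + -a) - R / Y - D - c * a := by
      rw [e1]
      apply div_nonneg
      · apply mul_nonneg <;> linarith
      · positivity
    nlinarith
  · have hne : affineForm r s ω w ≠ affineForm r s ω v := by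
      intro h
      exact hwv (eq_of_affineForm_eq hd (by rw [hwY, hvY]; simp) h)
    have hlt : affineForm r s ω v < affineForm r s ω w := by
      by_contra hle
      have hlt := lt_of_le_of_ne (not_lt.1 hle) hne
      simp only [Int.cast_zero, add_zero] at hW
      have he' : ((x : ℝ), (y : ℝ)) ∈ integerLattice := ⟨(x, y), rfl⟩
      have he1' : affineForm p q 0 ((x : ℝ), (y : ℝ)) = 1 := by
        simp only [affineForm]; linear_combination hxy'
      -- Pairing with a lattice vector of level 1 shows that distinct points of one level differ by
      -- at least `D` in `W`, too much for the window of `v`.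
      have hcr := abs_det_le_cross (p := p) (q := q) (r := r) (s := s)
        (sub_mem_integerLattice hvl hwl) he'
      rw [he1', affineForm_zero_sub r s ω, affineForm_zero_sub p q η v w, hwY, hvY] at hcr
      simp only [Int.cast_zero, add_zero, sub_self, mul_zero, sub_zero, mul_one] at hcr
      have := hcr (by linarith)
      linarith
    simp only [Int.cast_zero, add_zero]
    linarith
  · have hk1 : (1 : ℝ) ≤ k := by exact_mod_cast hk0
    have e1 : R / Y - R / (Y + k) = R / (Y * (Y + k)) * k := by
      have : Y + (k : ℝ) ≠ 0 := w1.ne'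
      field_simp
      ring
    have e2 : R / (Y * (Y + k)) * k ≤ R / (Y * (Y + 1)) * k := by gcongr
    have e3 : D ≤ D * k := by nlinarith
    have e4 : c * k = R / (Y * (Y + 1)) * k + D * k := by simp only [c]; ring
    nlinarith

/-- Dirichlet's theorem: a box of area more than `4 |det|` around the origin, in the coordinates
given by two integral forms, contains a nonzero lattice vector in its half. -/
theorem exists_short_lattice_vector (hpq : IsCoprime p q) (hd : p * s - q * r ≠ 0) {Y W : ℝ}
    (hY : 0 < Y) (hYW : 4 * ((|p * s - q * r| : ℤ) : ℝ) < Y * W) :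
    ∃ e ∈ integerLattice, e ≠ 0 ∧ |affineForm p q 0 e| ≤ Y / 2 ∧ |affineForm r s 0 e| ≤ W / 2 := by
  obtain ⟨e, he, he1, he2⟩ := exists_kernel_vector p q r s
  have hD : 0 < ((|p * s - q * r| : ℤ) : ℝ) := by exact_mod_cast abs_pos.2 hd
  set D := ((|p * s - q * r| : ℤ) : ℝ) with hDd
  have hW : 0 < W := pos_of_mul_pos_right (by linarith : 0 < Y * W) hY.le
  -- If `Y < 2`, the kernel vector already fits, because `4D < Y W < 2W`. Otherwise Dirichlet
  -- approximation of `W(z) / D` with denominators up to `⌊Y / 2⌋` supplies the vector.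
  by_cases hY2 : Y / 2 < 1
  · refine ⟨e, he, ?_, ?_, ?_⟩
    · rintro rfl
      simp [affineForm] at he2
      exact hD.ne he2
    · rw [he1]; simp; linarith
    · rw [he2, abs_of_pos hD]
      nlinarith
  · have hn : 0 < ⌊Y / 2⌋₊ := Nat.floor_pos.2 (not_lt.1 hY2)
    obtain ⟨x, y, hxy⟩ := hpq
    have hxy' : (x : ℝ) * p + y * q = 1 := by exact_mod_cast hxy
    set z : ℝ × ℝ := ((x : ℝ), (y : ℝ)) with hz
    have hzl : z ∈ integerLattice := ⟨(x, y), rfl⟩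
    have hz1 : affineForm p q 0 z = 1 := by
      simp only [affineForm, hz]; linear_combination hxy'
    obtain ⟨j, k, hk0, hkn, hjk⟩ :=
      Real.exists_int_int_abs_mul_sub_le (affineForm r s 0 z / D) hn
    have hk0' : (0 : ℝ) < k := by exact_mod_cast hk0
    have hkn' : (k : ℝ) ≤ Y / 2 :=
      (by exact_mod_cast hkn : (k : ℝ) ≤ ⌊Y / 2⌋₊).trans (Nat.floor_le (by linarith))
    set w := (k : ℝ) • z + ((-j : ℤ) : ℝ) • e with hw
    have hw1 : affineForm p q 0 w = k := by
      rw [hw, affineForm_add_smul, he1]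
      have := affineForm_add_smul p q 0 0 z k
      simp only [zero_add] at this
      rw [this, hz1]; simp [affineForm]
    have hw2 : affineForm r s 0 w = D * (k * (affineForm r s 0 z / D) - j) := by
      rw [hw, affineForm_add_smul, he2]
      have := affineForm_add_smul r s 0 0 z k
      simp only [zero_add] at this
      rw [this]
      have h0 : affineForm r s 0 0 = 0 := by simp [affineForm]
      rw [h0]
      field_simp
      push_cast
      ring
    refine ⟨w, add_mem_integerLattice (zsmul_mem_integerLattice hzl k)
      (zsmul_mem_integerLattice he _), ?_, ?_, ?_⟩
    · intro h
      rw [h] at hw1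
      simp [affineForm] at hw1
      exact hk0'.ne hw1
    · rw [hw1, abs_of_pos hk0']; exact hkn'
    · rw [hw2, abs_mul, abs_of_pos hD]
      have hfl := Nat.lt_floor_add_one (Y / 2)
      calc D * |(k : ℝ) * (affineForm r s 0 z / D) - j|
          ≤ D * (1 / ((⌊Y / 2⌋₊ : ℝ) + 1)) := by gcongr
        _ ≤ D * (1 / (Y / 2)) := by gcongr
        _ ≤ W / 2 := by
          rw [← mul_div_assoc, mul_one, div_le_iff₀ (by linarith)]
          linarith

/-- Vertices lie close to the hyperbola or to the corner of its asymptotes. -/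
theorem vertex_mul_le (hpq : IsCoprime p q) (hd : p * s - q * r ≠ 0) {v : ℝ × ℝ}
    (hv : v ∈ integerHullVertices (branchRegion p q r s η ω R)) :
    affineForm p q η v * affineForm r s ω v ≤ 4 * max R ((|p * s - q * r| : ℤ) : ℝ) := by
  by_contra! hlt
  have hv' := mem_of_mem_integerHullVertices hv
  obtain ⟨⟨hY, hW, -⟩, -⟩ := hv'
  have h1 : 4 * R < affineForm p q η v * affineForm r s ω v :=
    lt_of_le_of_lt (by gcongr; exact le_max_left _ _) hlt
  have h2 : 4 * ((|p * s - q * r| : ℤ) : ℝ) < affineForm p q η v * affineForm r s ω v :=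
    lt_of_le_of_lt (by gcongr; exact le_max_right _ _) hlt
  -- Adding or subtracting `e` leaves at least half of each coordinate, hence at least a quarter of
  -- the product, which still exceeds `R`.
  obtain ⟨e, he, hne, he1, he2⟩ := exists_short_lattice_vector hpq hd hY h2
  rw [abs_le] at he1 he2
  refine hne (eq_zero_of_add_mem_of_sub_mem hv he ⟨?_, ?_, ?_⟩ ⟨?_, ?_, ?_⟩) <;>
    simp only [affineForm_add, affineForm_sub]
  · linarith
  · linarith
  · calc R ≤ (affineForm p q η v / 2) * (affineForm r s ω v / 2) := by linarith
      _ ≤ _ := by gcongr <;> linarith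
  · linarith
  · linarith
  · calc R ≤ (affineForm p q η v / 2) * (affineForm r s ω v / 2) := by linarith
      _ ≤ _ := by gcongr <;> linarith

/-- Three vertices are in strictly convex position. -/
theorem vertex_convex_position (hd : p * s - q * r ≠ 0) {v₁ v₂ v₃ : ℝ × ℝ}
    (h1 : v₁ ∈ integerHullVertices (branchRegion p q r s η ω R))
    (h2 : v₂ ∈ integerHullVertices (branchRegion p q r s η ω R))
    (h3 : v₃ ∈ integerHullVertices (branchRegion p q r s η ω R))
    (h12 : affineForm p q η v₁ < affineForm p q η v₂)
    (h23 : affineForm p q η v₂ < affineForm p q η v₃) :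
    (affineForm r s ω v₂ - affineForm r s ω v₃) * (affineForm p q η v₂ - affineForm p q η v₁) <
      (affineForm r s ω v₁ - affineForm r s ω v₂) *
        (affineForm p q η v₃ - affineForm p q η v₂) := by
  by_contra! hle
  obtain ⟨e, he, he1, he2⟩ := exists_kernel_vector p q r s
  have hD : 0 < ((|p * s - q * r| : ℤ) : ℝ) := by exact_mod_cast abs_pos.2 hd
  set D := ((|p * s - q * r| : ℤ) : ℝ) with hDd
  obtain ⟨T2, L2⟩ := mem_of_mem_integerHullVertices h2
  set Y₁ := affineForm p q η v₁ with hY1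
  set Y₂ := affineForm p q η v₂ with hY2
  set Y₃ := affineForm p q η v₃ with hY3
  set W₁ := affineForm r s ω v₁ with hW1
  set W₂ := affineForm r s ω v₂ with hW2
  set W₃ := affineForm r s ω v₃ with hW3
  have hpos : 0 < Y₃ - Y₁ := by linarith
  set a := (Y₃ - Y₂) / (Y₃ - Y₁) with ha
  set b := (Y₂ - Y₁) / (Y₃ - Y₁) with hb
  have ha0 : 0 < a := div_pos (by linarith) hpos
  have hb0 : 0 < b := div_pos (by linarith) hpos
  have hab : a + b = 1 := by rw [ha, hb]; field_simp; ring
  -- `u` is the point of the chord from `v₁` to `v₃` on the level of `v₂`. If convexity fails, `v₂`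
  -- lies on or above `u`, so it is `u` itself or interior to the segment from `u` to `v₂ + e`;
  -- extremality then forces `v₂ = u`, and in turn `v₁ = v₂`.
  set u := a • v₁ + b • v₃ with hu
  have huY : affineForm p q η u = Y₂ := by
    rw [hu, affineForm_combo p q η _ _ hab, ← hY1, ← hY3, ha, hb]; field_simp; ring
  have huW : affineForm r s ω u = a * W₁ + b * W₃ := by
    rw [hu, affineForm_combo r s ω _ _ hab]
  have huW2 : 0 ≤ W₂ - affineForm r s ω u := by
    have : W₂ - affineForm r s ω u =
        ((W₂ - W₃) * (Y₂ - Y₁) - (W₁ - W₂) * (Y₃ - Y₂)) / (Y₃ - Y₁) := by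
      rw [huW, ha, hb]; field_simp; ring
    rw [this]
    exact div_nonneg (by linarith) hpos.le
  set t := (W₂ - affineForm r s ω u) / D with ht
  have ht0 : 0 ≤ t := div_nonneg huW2 hD.le
  have hv2 : v₂ = u + t • e := by
    refine eq_of_affineForm_eq hd (η := η) (ω := ω) ?_ ?_
    · rw [affineForm_add_smul, he1, huY, mul_zero, add_zero]
    · rw [affineForm_add_smul, he2, ht]; field_simp; ring
  have huh : u ∈ convexHull ℝ (branchRegion p q r s η ω R ∩ integerLattice) :=
    convex_convexHull ℝ _ h1.1 h3.1 ha0.le hb0.le hab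
  have huv : u = v₂ := by
    rcases ht0.eq_or_lt with h0 | h0
    · rw [hv2, ← h0]; simp
    · refine h2.2 huh (x₂ := v₂ + e) (subset_convexHull ℝ _
        ⟨add_mem_branchRegion T2 he1.ge (by rw [he2]; exact hD.le),
          add_mem_integerLattice L2 he⟩) ⟨1 / (1 + t), t / (1 + t), by positivity, by positivity,
          by field_simp, ?_⟩
      have h1t : 1 + t ≠ 0 := by positivity
      have hcoef : t / (1 + t) = t * (1 / (1 + t)) := by ring
      have hcoef' : (1 / (1 + t)) * (1 + t) = 1 := by field_simp
      calc (1 / (1 + t)) • u + (t / (1 + t)) • (v₂ + e)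
          = (1 / (1 + t)) • (u + t • e) + (t * (1 / (1 + t))) • v₂ := by rw [hcoef]; module
        _ = (1 / (1 + t)) • v₂ + (t * (1 / (1 + t))) • v₂ := by rw [← hv2]
        _ = ((1 / (1 + t)) * (1 + t)) • v₂ := by module
        _ = v₂ := by rw [hcoef', one_smul]
  have h12' : v₁ = v₂ := h2.2 h1.1 h3.1 ⟨a, b, ha0, hb0, hab, huv⟩
  rw [hY1, hY2, h12'] at h12
  exact lt_irrefl _ h12

/-- Cross products of edges of the integer hull are bounded below. -/
theorem abs_det_le_edge_cross (hd : p * s - q * r ≠ 0) {v₁ v₂ v₃ v₄ : ℝ × ℝ}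
    (h1 : v₁ ∈ integerHullVertices (branchRegion p q r s η ω R))
    (h2 : v₂ ∈ integerHullVertices (branchRegion p q r s η ω R))
    (h3 : v₃ ∈ integerHullVertices (branchRegion p q r s η ω R))
    (h4 : v₄ ∈ integerHullVertices (branchRegion p q r s η ω R))
    (h12 : affineForm p q η v₁ < affineForm p q η v₂)
    (h23 : affineForm p q η v₂ ≤ affineForm p q η v₃)
    (h34 : affineForm p q η v₃ < affineForm p q η v₄) :
    ((|p * s - q * r| : ℤ) : ℝ) ≤
      (affineForm r s ω v₁ - affineForm r s ω v₂) * (affineForm p q η v₄ - affineForm p q η v₃) -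
      (affineForm r s ω v₃ - affineForm r s ω v₄) *
        (affineForm p q η v₂ - affineForm p q η v₁) := by
  have hpos : (affineForm r s ω v₃ - affineForm r s ω v₄) *
      (affineForm p q η v₂ - affineForm p q η v₁) <
      (affineForm r s ω v₁ - affineForm r s ω v₂) *
        (affineForm p q η v₄ - affineForm p q η v₃) := by
    rcases h23.eq_or_lt with h | h
    · have hv := vertex_eq_of_level_eq h2 h3 h
      subst hv
      exact vertex_convex_position hd h1 h2 h4 h12 h34
    · have c1 := vertex_convex_position hd h1 h2 h3 h12 h
      have c2 := vertex_convex_position hd h2 h3 h4 h h34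
      rw [← sub_pos] at h12 h h34 c1 c2 ⊢
      have := add_pos (mul_pos c1 h34) (mul_pos c2 h12)
      -- For edge vectors `e₁, e₂, e₃` with `Y`-extents `y₁, y₂, y₃`, the identity is `y₂ (e₁ × e₃)
      -- = y₃ (e₁ × e₂) + y₁ (e₂ × e₃)`.
      refine pos_of_mul_pos_right (a := affineForm p q η v₃ - affineForm p q η v₂) ?_ h.le
      calc (0 : ℝ) < _ := this
        _ = _ := by ring
  have l1 := (mem_of_mem_integerHullVertices h1).2
  have l2 := (mem_of_mem_integerHullVertices h2).2
  have l3 := (mem_of_mem_integerHullVertices h3).2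
  have l4 := (mem_of_mem_integerHullVertices h4).2
  have e : affineForm r s 0 (v₁ - v₂) * affineForm p q 0 (v₃ - v₄) -
      affineForm r s 0 (v₃ - v₄) * affineForm p q 0 (v₁ - v₂) =
      -((affineForm r s ω v₁ - affineForm r s ω v₂) *
        (affineForm p q η v₄ - affineForm p q η v₃) -
      (affineForm r s ω v₃ - affineForm r s ω v₄) *
        (affineForm p q η v₂ - affineForm p q η v₁)) := by
    simp only [affineForm_zero_sub p q η, affineForm_zero_sub r s ω]; ring
  have e' : affineForm r s 0 (v₃ - v₄) * affineForm p q 0 (v₁ - v₂) -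
      affineForm r s 0 (v₁ - v₂) * affineForm p q 0 (v₃ - v₄) =
      (affineForm r s ω v₁ - affineForm r s ω v₂) *
        (affineForm p q η v₄ - affineForm p q η v₃) -
      (affineForm r s ω v₃ - affineForm r s ω v₄) *
        (affineForm p q η v₂ - affineForm p q η v₁) := by linarith
  have := abs_det_le_cross (p := p) (q := q) (r := r) (s := s)
    (sub_mem_integerLattice l3 l4) (sub_mem_integerLattice l1 l2)
  rw [e'] at this
  exact this (by linarith)

end Vertices

/-! ### Counting the vertices -/

section Count

variable {p q r s : ℤ} {η ω R : ℝ}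

/-- The number of vertices in a dyadic block of levels. -/
theorem card_vertices_block_le (hpq : IsCoprime p q) (hd : p * s - q * r ≠ 0) {κ B : ℝ}
    (hκ : 0 < κ) (hB : 0 < B)
    (hκR : κ ^ 3 * ((|p * s - q * r| : ℤ) : ℝ) = 4 * max R ((|p * s - q * r| : ℤ) : ℝ))
    {F : Finset (ℝ × ℝ)}
    (hF : ∀ v ∈ F, v ∈ integerHullVertices (branchRegion p q r s η ω R) ∧
      B ≤ affineForm p q η v ∧ affineForm p q η v < 2 * B) :
    (F.card : ℝ) ≤ 8 * κ := by
  classical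
  have hD : 0 < ((|p * s - q * r| : ℤ) : ℝ) := by exact_mod_cast abs_pos.2 hd
  have hmul := fun v hv => vertex_mul_le (η := η) (ω := ω) (R := R) hpq hd (v := v) (hF v hv).1
  have hmax := le_max_right R ((|p * s - q * r| : ℤ) : ℝ)
  have hcross := @abs_det_le_edge_cross p q r s η ω R hd
  set D := ((|p * s - q * r| : ℤ) : ℝ) with hDd
  have hκ1 : 1 ≤ κ := by
    by_contra! h
    have : κ ^ 3 < 1 := pow_lt_one₀ hκ.le h (by norm_num)
    nlinarith
  rcases Nat.eq_zero_or_eq_succ_pred F.card with h0 | hk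
  · rw [h0]; push_cast; positivity
  generalize F.card.pred = k at hk
  have hinj : (F.image (affineForm p q η)).card = k + 1 := by
    rw [Finset.card_image_of_injOn, hk]
    intro v hv w hw h
    exact vertex_eq_of_level_eq (hF v hv).1 (hF w hw).1 h
  obtain ⟨g, hg, hmono⟩ := exists_strictMonoOn_enumeration _ hinj
  choose v hvF hvg using fun i => Finset.mem_image.1 (hg i)
  have hlt : ∀ i j, i < j → j ≤ k → affineForm p q η (v i) < affineForm p q η (v j) := by
    intro i j hij hj
    rw [hvg, hvg]
    exact hmono i j hij hj
  have hV := fun i => (hF (v i) (hvF i)).1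
  -- The vectors are the edges, with `W`-extents divided by `D` to normalize cross products. Their
  -- total `W`-extent is below `W (v 0) ≤ 4 max(R, D) / B`, which gives `A = κ³ / B`. Then `A B =
  -- κ³` balances the terms of the chain bound: `k ≤ 6κ + 1`, hence `k + 1 ≤ 8κ` as `κ ≥ 1`.
  have hchain := chain_bound (k := k)
    (a := fun i => (affineForm r s ω (v i) - affineForm r s ω (v (i + 1))) / D)
    (b := fun i => affineForm p q η (v (i + 1)) - affineForm p q η (v i))
    (A := κ ^ 3 / B) (B := B) (κ := κ) (by positivity) hB hκ
    (fun i hi => div_pos (sub_pos.2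
      (vertex_strictAnti (hV i) (hV (i + 1)) (hlt i (i + 1) (by omega) (by omega)))) hD)
    (fun i hi => sub_pos.2 (hlt i (i + 1) (by omega) (by omega)))
    (by
      rw [← Finset.sum_div, Finset.sum_range_sub', div_le_div_iff₀ hD hB, hκR]
      have h1 := (mem_of_mem_integerHullVertices (hV 0)).1.2.1
      have h2 := (mem_of_mem_integerHullVertices (hV k)).1.2.1
      have h3 := hmul _ (hvF 0)
      have h4 := (hF _ (hvF 0)).2.1
      nlinarith)
    (by
      rw [Finset.sum_range_sub fun i => affineForm p q η (v i)]
      have h1 := (hF _ (hvF 0)).2.1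
      have h2 := (hF _ (hvF k)).2.2
      linarith)
    (fun i j hij hj => by
      have hle : affineForm p q η (v (i + 1)) ≤ affineForm p q η (v j) := by
        rcases (Nat.succ_le_of_lt hij).eq_or_lt with h | h
        · rw [← h]
        · exact (hlt (i + 1) j h (by omega)).le
      have := hcross (hV i) (hV (i + 1)) (hV j) (hV (j + 1))
        (hlt i (i + 1) (by omega) (by omega)) hle (hlt j (j + 1) (by omega) (by omega))
      rw [div_mul_eq_mul_div, div_mul_eq_mul_div, ← sub_div, le_div_iff₀ hD]
      linarith)
  have e : 4 * (κ ^ 3 / B * B) / κ ^ 2 = 4 * κ := by field_simp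
  rw [e] at hchain
  rw [hk]
  push_cast
  linarith

/-- The number of vertices with level less than `1` is at most `1`. -/
theorem card_filter_level_lt_one_le {F : Finset (ℝ × ℝ)}
    (hF : ∀ v ∈ F, v ∈ integerHullVertices (branchRegion p q r s η ω R)) :
    (F.filter fun v => affineForm p q η v < 1).card ≤ 1 := by
  rw [Finset.card_le_one]
  intro v hv w hw
  rw [Finset.mem_filter] at hv hw
  exact vertex_eq_of_level_lt_one (hF v hv.1) (hF w hw.1) hv.2 hw.2

/-- The 2 accounts for one vertex with `Y < 1` and one with `W < 1`. For every other vertex `1 ≤ Y ≤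
Y W ≤ 4 max(R, D) < 2 ^ L`, so `L` dyadic blocks cover them. -/
theorem card_vertices_le (hpq : IsCoprime p q) (hd : p * s - q * r ≠ 0)
    {κ : ℝ} (hκ : 0 < κ)
    (hκR : κ ^ 3 * ((|p * s - q * r| : ℤ) : ℝ) = 4 * max R ((|p * s - q * r| : ℤ) : ℝ))
    {L : ℕ} (hL : 4 * max R ((|p * s - q * r| : ℤ) : ℝ) < 2 ^ L)
    {F : Finset (ℝ × ℝ)}
    (hF : ∀ v ∈ F, v ∈ integerHullVertices (branchRegion p q r s η ω R)) :
    (F.card : ℝ) ≤ 2 + L * (8 * κ) := by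
  classical
  let block : ℕ → Finset (ℝ × ℝ) := fun i =>
    F.filter fun v => 2 ^ i ≤ affineForm p q η v ∧ affineForm p q η v < 2 * 2 ^ i
  have hblock : ∀ i, ((block i).card : ℝ) ≤ 8 * κ := fun i =>
    card_vertices_block_le (η := η) (ω := ω) (R := R) hpq hd hκ (B := 2 ^ i) (by positivity) hκR
      fun v hv => ⟨hF v (Finset.mem_filter.1 hv).1, (Finset.mem_filter.1 hv).2⟩
  have hsub : F ⊆ ((F.filter fun v => affineForm p q η v < 1) ∪
      (F.filter fun v => affineForm r s ω v < 1)) ∪ (Finset.range L).biUnion block := by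
    intro v hv
    simp only [Finset.mem_union, Finset.mem_filter, Finset.mem_biUnion, Finset.mem_range, block]
    by_cases h1 : affineForm p q η v < 1
    · exact Or.inl (Or.inl ⟨hv, h1⟩)
    by_cases h2 : affineForm r s ω v < 1
    · exact Or.inl (Or.inr ⟨hv, h2⟩)
    rw [not_lt] at h1 h2
    obtain ⟨i, hi1, hi2⟩ := exists_nat_pow_near h1 (one_lt_two : (1 : ℝ) < 2)
    refine Or.inr ⟨i, ?_, hv, hi1, by rwa [pow_succ'] at hi2⟩
    have h3 := vertex_mul_le hpq hd (hF v hv)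
    have h4 : (2 : ℝ) ^ i < 2 ^ L := by nlinarith
    exact (pow_lt_pow_iff_right₀ (one_lt_two : (1 : ℝ) < 2)).1 h4
  have hswap : (F.filter fun v => affineForm r s ω v < 1).card ≤ 1 :=
    card_filter_level_lt_one_le (p := r) (q := s) (r := p) (s := q) (η := ω) (ω := η) (R := R)
      (by rwa [branchRegion_swap])
  have hcard : F.card ≤ 1 + 1 + ∑ i ∈ Finset.range L, (block i).card := by
    refine (Finset.card_le_card hsub).trans ((Finset.card_union_le _ _).trans ?_)
    refine add_le_add ((Finset.card_union_le _ _).trans ?_) Finset.card_biUnion_le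
    exact add_le_add (card_filter_level_lt_one_le hF) hswap
  have hsum : ∑ i ∈ Finset.range L, ((block i).card : ℝ) ≤ L * (8 * κ) := by
    simpa using Finset.sum_le_card_nsmul (Finset.range L) _ _ fun i _ => hblock i
  have : (F.card : ℝ) ≤ ((1 + 1 + ∑ i ∈ Finset.range L, (block i).card : ℕ) : ℝ) := by
    exact_mod_cast hcard
  push_cast at this
  linarith

/-- Both bounds on the number of vertices, for the region cut out by two primitive forms. -/
theorem vertices_finite_and_le (hpq : IsCoprime p q) (hd : p * s - q * r ≠ 0) {m : ℝ}
    (hm1 : 2 * ((|p * s - q * r| : ℤ) : ℝ) ≤ m) (hm2 : R ≤ m * ((|p * s - q * r| : ℤ) : ℝ)) :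
    (integerHullVertices (branchRegion p q r s η ω R)).Finite ∧
      ((integerHullVertices (branchRegion p q r s η ω R)).ncard : ℝ) ≤
        34 * m ^ ((1 : ℝ) / 3) * (Real.logb 2 m + 2) := by
  have hD1 : 1 ≤ ((|p * s - q * r| : ℤ) : ℝ) := by exact_mod_cast Int.one_le_abs hd
  set D := ((|p * s - q * r| : ℤ) : ℝ) with hDd
  have hm : 2 ≤ m := by linarith
  have hm0 : 0 < m := by linarith
  set N := 4 * max R D with hN
  have hNpos : 0 < N := by
    have := le_max_right R D
    rw [hN]; linarith
  have hND : N ≤ 4 * m * D := by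
    have : max R D ≤ m * D := max_le hm2 (by nlinarith)
    rw [hN]; linarith
  set κ := (N / D) ^ ((1 : ℝ) / 3) with hκd
  have hD0 : 0 < D := by linarith
  have hκ : 0 < κ := by positivity
  have hκ3 : κ ^ 3 * D = N := by
    rw [hκd, ← Real.rpow_natCast, ← Real.rpow_mul (by positivity)]
    norm_num
    field_simp
  -- `κ³ = N / D ≤ 4m`, relaxed to `8m` for the sake of an exact cube root.
  have hκm : κ ≤ 2 * m ^ ((1 : ℝ) / 3) := by
    have h8 : (8 : ℝ) ^ ((1 : ℝ) / 3) = 2 := by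
      rw [show (8 : ℝ) = 2 ^ (3 : ℝ) by norm_num, ← Real.rpow_mul (by norm_num)]; norm_num
    rw [← h8, ← Real.mul_rpow (by norm_num) hm0.le, hκd]
    gcongr
    rw [div_le_iff₀ hD0]
    nlinarith
  set l := Real.logb 2 m with hl
  have hl1 : 1 ≤ l := by
    rw [hl, Real.le_logb_iff_rpow_le (by norm_num) hm0]; simpa using hm
  -- Chosen so that `2 ^ L > 2 m² ≥ N`; the last inequality uses `2D ≤ m`.
  set L := ⌊1 + 2 * l⌋₊ + 1 with hLd
  have hLle : (L : ℝ) ≤ 2 + 2 * l := by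
    have := Nat.floor_le (a := 1 + 2 * l) (by linarith)
    rw [hLd]; push_cast; linarith
  have hL : N < 2 ^ L := by
    have h1 : N ≤ 2 * m ^ 2 := by nlinarith
    refine h1.trans_lt ?_
    have h2 : (1 + 2 * l : ℝ) < L := by
      rw [hLd]; push_cast; exact Nat.lt_floor_add_one _
    have h3 : (2 : ℝ) ^ l = m := Real.rpow_logb (by norm_num) (by norm_num) hm0
    calc 2 * m ^ 2 = (2 : ℝ) ^ (1 + 2 * l) := by
          rw [Real.rpow_add (by norm_num), two_mul l, Real.rpow_add (by norm_num), h3]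
          norm_num; ring
      _ < (2 : ℝ) ^ (L : ℝ) := Real.rpow_lt_rpow_of_exponent_lt (by norm_num) h2
      _ = 2 ^ L := Real.rpow_natCast _ _
  have hm3 : 1 ≤ m ^ ((1 : ℝ) / 3) := Real.one_le_rpow (by linarith) (by norm_num)
  have hfinal : 2 + (L : ℝ) * (8 * κ) ≤ 34 * m ^ ((1 : ℝ) / 3) * (l + 2) := by
    calc 2 + (L : ℝ) * (8 * κ) ≤ 2 + (2 + 2 * l) * (8 * (2 * m ^ ((1 : ℝ) / 3))) := by gcongr
      _ ≤ _ := by nlinarith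
  have hcard : ∀ F : Finset (ℝ × ℝ),
      (∀ v ∈ F, v ∈ integerHullVertices (branchRegion p q r s η ω R)) →
      (F.card : ℝ) ≤ 2 + L * (8 * κ) := fun F hF => card_vertices_le hpq hd hκ hκ3 hL hF
  -- The bound is uniform over finite sets of vertices, so finiteness comes with it.
  have hfin : (integerHullVertices (branchRegion p q r s η ω R)).Finite := by
    by_contra hinf
    obtain ⟨F, hF, hFc⟩ := Set.Infinite.exists_subset_card_eq hinf (⌊2 + L * (8 * κ)⌋₊ + 1)
    have h1 := hcard F fun v hv => hF hv
    have h2 := Nat.lt_floor_add_one (2 + L * (8 * κ))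
    rw [hFc] at h1
    push_cast at h1
    linarith
  refine ⟨hfin, ?_⟩
  rw [Set.ncard_eq_toFinset_card _ hfin]
  exact (hcard _ fun v hv => hfin.mem_toFinset.1 hv).trans hfinal

/-- The number of vertices at small height above one asymptote. -/
theorem le_ncard_vertices_low (hpq : IsCoprime p q) (hd : p * s - q * r ≠ 0) (hR : 0 < R)
    (hfin : (integerHullVertices (branchRegion p q r s η ω R)).Finite) {μ : ℝ}
    (hμR : ((|p * s - q * r| : ℤ) : ℝ) * μ ^ 3 ≤ R) :
    μ - 1 ≤ ((integerHullVertices (branchRegion p q r s η ω R) ∩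
      {v | affineForm p q η v ≤ μ}).ncard : ℝ) := by
  have hD : 0 < ((|p * s - q * r| : ℤ) : ℝ) := by exact_mod_cast abs_pos.2 hd
  set A := integerHullVertices (branchRegion p q r s η ω R) ∩ {v | affineForm p q η v ≤ μ} with hA
  have hAfin : A.Finite := hfin.inter_of_left _
  -- These `t` are exactly the integers with `0 < t - η ≤ μ`; there are more than `μ - 1` of them.
  have hex : ∀ t ∈ Finset.Ioc ⌊η⌋ ⌊η + μ⌋, ∃ v ∈ A, affineForm p q η v = t - η := by
    intro t ht
    rw [Finset.mem_Ioc, Int.floor_lt, Int.le_floor] at ht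
    obtain ⟨v, hv, hvt⟩ := exists_vertex_of_level (η := η) (ω := ω) hpq hd t (by linarith) hR
      (le_trans (by gcongr <;> linarith) hμR)
    exact ⟨v, ⟨hv, by rw [Set.mem_ofPred_eq, hvt]; linarith⟩, hvt⟩
  choose! f hfA hft using hex
  have hcard : (Finset.Ioc ⌊η⌋ ⌊η + μ⌋).card ≤ hAfin.toFinset.card := by
    refine Finset.card_le_card_of_injOn f (fun t ht => ?_) fun t ht t' ht' h => ?_
    · exact hAfin.mem_toFinset.2 (hfA t ht)
    · have h1 := hft t ht
      have h2 := hft t' ht'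
      rw [h, h2] at h1
      have : (t' : ℝ) = t := by linarith
      exact_mod_cast this.symm
  rw [Set.ncard_eq_toFinset_card _ hAfin]
  rw [Int.card_Ioc] at hcard
  have h1 : ⌊η + μ⌋ - ⌊η⌋ ≤ (hAfin.toFinset.card : ℤ) :=
    (Int.self_le_toNat _).trans (by exact_mod_cast hcard)
  have h2 : ((⌊η + μ⌋ : ℤ) : ℝ) - ⌊η⌋ ≤ hAfin.toFinset.card := by exact_mod_cast h1
  have h3 := Int.floor_le η
  have h4 := Int.lt_floor_add_one (η + μ)
  linarith

/-- The low vertices are counted along each asymptote, which is why both forms must be primitive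
here. For `μ ≤ 1` the left side is not positive; for `μ > 1` the two families are disjoint. -/
theorem le_ncard_vertices (hpq : IsCoprime p q) (hrs : IsCoprime r s) (hd : p * s - q * r ≠ 0)
    (hR : 0 < R) (hfin : (integerHullVertices (branchRegion p q r s η ω R)).Finite) :
    2 * (R / ((|p * s - q * r| : ℤ) : ℝ)) ^ ((1 : ℝ) / 3) - 2 ≤
      ((integerHullVertices (branchRegion p q r s η ω R)).ncard : ℝ) := by
  have hD1 : 1 ≤ ((|p * s - q * r| : ℤ) : ℝ) := by exact_mod_cast Int.one_le_abs hd
  have hD0 : 0 < ((|p * s - q * r| : ℤ) : ℝ) := by linarith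
  have hlow := fun μ => le_ncard_vertices_low (μ := μ) hpq hd hR hfin
  have habs : |r * q - s * p| = |p * s - q * r| := by rw [← abs_neg]; congr 1; ring
  have hlow' := fun μ => le_ncard_vertices_low (p := r) (q := s) (r := p) (s := q) (η := ω)
    (ω := η) (R := R) (μ := μ) hrs (by rw [← abs_pos, habs, abs_pos]; exact hd) hR
    (by rwa [branchRegion_swap])
  rw [habs, branchRegion_swap] at hlow'
  set D := ((|p * s - q * r| : ℤ) : ℝ) with hDd
  set μ := (R / D) ^ ((1 : ℝ) / 3) with hμd
  have hμ : 0 < μ := by positivity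
  have hμ3 : D * μ ^ 3 = R := by
    rw [hμd, ← Real.rpow_natCast, ← Real.rpow_mul (by positivity)]
    norm_num
    field_simp
  by_cases hμ1 : μ ≤ 1
  · have : (0 : ℝ) ≤ ((integerHullVertices (branchRegion p q r s η ω R)).ncard : ℝ) := by
      positivity
    linarith
  rw [not_le] at hμ1
  have h1 := hlow μ hμ3.le
  have h2 := hlow' μ hμ3.le
  set V := integerHullVertices (branchRegion p q r s η ω R) with hV
  have hdisj : Disjoint (V ∩ {v | affineForm p q η v ≤ μ}) (V ∩ {v | affineForm r s ω v ≤ μ}) := by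
    rw [Set.disjoint_left]
    rintro v ⟨hv, hv1⟩ ⟨-, hv2⟩
    rw [Set.mem_ofPred_eq] at hv1 hv2
    obtain ⟨⟨a, b, c⟩, -⟩ := mem_of_mem_integerHullVertices hv
    have h3 : affineForm p q η v * affineForm r s ω v ≤ μ * μ := by gcongr
    have h4 : μ * μ < D * μ ^ 3 := by
      calc μ * μ < μ ^ 3 := by nlinarith [mul_pos hμ hμ]
        _ ≤ D * μ ^ 3 := by nlinarith [pow_pos hμ 3]
    linarith
  have h3 := Set.ncard_union_eq hdisj (hfin.inter_of_left _) (hfin.inter_of_left _)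
  have h4 := Set.ncard_le_ncard (Set.union_subset (Set.inter_subset_left (s := V)
    (t := {v | affineForm p q η v ≤ μ})) (Set.inter_subset_left (s := V)
    (t := {v | affineForm r s ω v ≤ μ}))) hfin
  rw [h3] at h4
  have h5 : ((V ∩ {v | affineForm p q η v ≤ μ}).ncard : ℝ) +
      ((V ∩ {v | affineForm r s ω v ≤ μ}).ncard : ℝ) ≤ V.ncard := by exact_mod_cast h4
  linarith

end Count

/-! ### Components of the complement of a hyperbola -/

section Components

variable {p q r s : ℤ} {η ω R : ℝ}

theorem continuous_affineForm (p q : ℤ) (η : ℝ) : Continuous (affineForm p q η) := by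
  unfold affineForm; fun_prop

theorem affineForm_neg (p q : ℤ) (η : ℝ) (v : ℝ × ℝ) :
    affineForm (-p) (-q) (-η) v = -affineForm p q η v := by
  simp only [affineForm]; push_cast; ring

theorem exists_affineForm_eq (hd : p * s - q * r ≠ 0) (η ω y w : ℝ) :
    ∃ v, affineForm p q η v = y ∧ affineForm r s ω v = w := by
  have hd' : (p : ℝ) * s - q * r ≠ 0 := by exact_mod_cast hd
  refine ⟨((s * (y + η) - q * (w + ω)) / (p * s - q * r),
    (p * (w + ω) - r * (y + η)) / (p * s - q * r)), ?_, ?_⟩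
  all_goals
    simp only [affineForm]
    rw [sub_eq_iff_eq_add, ← mul_div_assoc, ← mul_div_assoc, ← add_div, div_eq_iff hd']
    ring

/-- The interior of a branch region. -/
def openBranchRegion (p q r s : ℤ) (η ω R : ℝ) : Set (ℝ × ℝ) :=
  {v | 0 < affineForm p q η v ∧ R < affineForm p q η v * affineForm r s ω v}

theorem openBranchRegion_pos (hR : 0 < R) {v : ℝ × ℝ} (hv : v ∈ openBranchRegion p q r s η ω R) :
    0 < affineForm r s ω v :=
  pos_of_mul_pos_right (hR.trans hv.2) hv.1.le

theorem isOpen_openBranchRegion : IsOpen (openBranchRegion p q r s η ω R) :=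
  (isOpen_lt continuous_const (continuous_affineForm p q η)).inter
    (isOpen_lt continuous_const ((continuous_affineForm p q η).mul (continuous_affineForm r s ω)))

theorem convex_openBranchRegion (hR : 0 < R) : Convex ℝ (openBranchRegion p q r s η ω R) := by
  rw [convex_iff_forall_pos]
  intro x hx y hy a b ha hb hab
  have hxW := openBranchRegion_pos hR hx
  have hyW := openBranchRegion_pos hR hy
  obtain ⟨hx1, hx2⟩ := hx
  obtain ⟨hy1, hy2⟩ := hy
  rw [openBranchRegion, Set.mem_ofPred_eq, affineForm_combo p q η _ _ hab,
    affineForm_combo r s ω _ _ hab]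
  set x1 := affineForm p q η x
  set x2 := affineForm r s ω x
  set y1 := affineForm p q η y
  set y2 := affineForm r s ω y
  refine ⟨by positivity, ?_⟩
  -- AM-GM: the square of the right side is at least `4 (x1 x2)(y1 y2) > 4R²`.
  have h : 2 * R < x1 * y2 + y1 * x2 := by
    refine lt_of_pow_lt_pow_left₀ 2 (by positivity) ?_
    have h1 : R * R < (x1 * x2) * (y1 * y2) := mul_lt_mul'' hx2 hy2 hR.le hR.le
    nlinarith [sq_nonneg (x1 * y2 - y1 * x2)]
  calc R = a * a * R + b * b * R + a * b * (2 * R) := by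
        linear_combination (-(R * (a + b + 1))) * hab
    _ < a * a * (x1 * x2) + b * b * (y1 * y2) + a * b * (x1 * y2 + y1 * x2) := by gcongr
    _ = _ := by ring

theorem closure_openBranchRegion (hR : 0 < R) (hd : p * s - q * r ≠ 0) :
    closure (openBranchRegion p q r s η ω R) = branchRegion p q r s η ω R := by
  have hYc := continuous_affineForm p q η
  have hWc := continuous_affineForm r s ω
  apply Set.Subset.antisymm
  · have hcl : IsClosed {v | 0 ≤ affineForm p q η v ∧ 0 ≤ affineForm r s ω v ∧
        R ≤ affineForm p q η v * affineForm r s ω v} :=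
      (isClosed_le continuous_const hYc).inter ((isClosed_le continuous_const hWc).inter
        (isClosed_le continuous_const (hYc.mul hWc)))
    refine (closure_minimal (fun v hv => ?_) hcl).trans fun v hv => ?_
    · exact ⟨hv.1.le, (openBranchRegion_pos hR hv).le, hv.2.le⟩
    · obtain ⟨h1, h2, h3⟩ := hv
      have h4 := hR.trans_le h3
      exact ⟨pos_of_mul_pos_left h4 h2, pos_of_mul_pos_right h4 h1, h3⟩
  · rintro v ⟨h1, h2, h3⟩
    -- `z` points from the center of the hyperbola to `v`; moving along it multiplies both forms by
    -- `1 + t` and so enters the open region.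
    obtain ⟨z, hz1, hz2⟩ := exists_affineForm_eq hd 0 0 (affineForm p q η v) (affineForm r s ω v)
    have ht : Filter.Tendsto (fun t : ℝ => v + t • z) (nhdsWithin 0 (Set.Ioi 0)) (nhds v) := by
      have : Continuous fun t : ℝ => v + t • z := by fun_prop
      have := (this.tendsto 0).mono_left (nhdsWithin_le_nhds (s := Set.Ioi 0))
      simpa using this
    refine mem_closure_of_tendsto ht ?_
    filter_upwards [self_mem_nhdsWithin] with t ht0
    rw [Set.mem_Ioi] at ht0
    rw [openBranchRegion, Set.mem_ofPred_eq, affineForm_add_smul, affineForm_add_smul, hz1, hz2]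
    refine ⟨by positivity, h3.trans_lt ?_⟩
    have : 0 < affineForm p q η v * affineForm r s ω v := by positivity
    nlinarith [mul_pos ht0 this]

/-- The component of the complement of a hyperbola through a point beyond one of its branches. -/
theorem connectedComponentIn_eq_openBranchRegion (hR : 0 < R) {v : ℝ × ℝ}
    (hv : v ∈ openBranchRegion p q r s η ω R) :
    connectedComponentIn {v | affineForm p q η v * affineForm r s ω v = R}ᶜ v =
      openBranchRegion p q r s η ω R := by
  have hYc := continuous_affineForm p q η
  have hWc := continuous_affineForm r s ω
  have hsub : openBranchRegion p q r s η ω R ⊆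
      {v | affineForm p q η v * affineForm r s ω v = R}ᶜ := fun w hw => hw.2.ne'
  apply Set.Subset.antisymm
  · have hB : IsOpen ({v | affineForm p q η v * affineForm r s ω v < R} ∪
        {v | affineForm p q η v < 0}) :=
      (isOpen_lt (hYc.mul hWc) continuous_const).union (isOpen_lt hYc continuous_const)
    refine IsPreconnected.subset_left_of_subset_union isOpen_openBranchRegion hB ?_ ?_
      ⟨v, mem_connectedComponentIn (hsub hv), hv⟩ isPreconnected_connectedComponentIn
    · rw [Set.disjoint_left]
      rintro w ⟨h1, h2⟩ (h3 | h3)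
      · exact lt_asymm h2 h3
      · exact lt_asymm h1 h3
    · intro w hw
      have hne : affineForm p q η w * affineForm r s ω w ≠ R := connectedComponentIn_subset _ _ hw
      rcases lt_or_gt_of_ne hne with h | h
      · exact Or.inr (Or.inl h)
      · rcases lt_trichotomy (affineForm p q η w) 0 with h' | h' | h'
        · exact Or.inr (Or.inr h')
        · rw [h', zero_mul] at h
          exact absurd h (not_lt.2 hR.le)
        · exact Or.inl ⟨h', h⟩
  · exact (convex_openBranchRegion hR).isPreconnected.subset_connectedComponentIn hv hsub

/-- The component between the two branches of a hyperbola is not convex. -/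
theorem not_convex_middle_component (hR : 0 < R) (hd : p * s - q * r ≠ 0) {v : ℝ × ℝ}
    (hv : affineForm p q η v * affineForm r s ω v < R) :
    ¬Convex ℝ
      (connectedComponentIn {v | affineForm p q η v * affineForm r s ω v = R}ᶜ v) := by
  intro hconv
  obtain ⟨z, hz1, hz2⟩ := exists_affineForm_eq hd η ω 0 0
  obtain ⟨x, hx1, hx2⟩ := exists_affineForm_eq hd η ω (2 * √R) 0
  obtain ⟨y, hy1, hy2⟩ := exists_affineForm_eq hd η ω 0 (2 * √R)
  -- The middle region is star-shaped about the center, hence connected, and contains points `x`,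
  -- `y` on the two asymptotes whose midpoint has both forms equal to `√R`, on the hyperbola.
  have hstar : StarConvex ℝ z {v | affineForm p q η v * affineForm r s ω v < R} := by
    intro w hw a b ha hb hab
    rw [Set.mem_ofPred_eq] at hw ⊢
    rw [affineForm_combo p q η _ _ hab, affineForm_combo r s ω _ _ hab, hz1, hz2]
    have hb1 : b * b ≤ 1 := by nlinarith
    rcases le_total 0 (affineForm p q η w * affineForm r s ω w) with h | h
    · nlinarith [mul_nonneg hb hb]
    · nlinarith [mul_nonneg hb hb, mul_nonpos_of_nonneg_of_nonpos (mul_nonneg hb hb) h]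
  have hsub := hstar.isPathConnected (by rw [Set.mem_ofPred_eq, hz1, zero_mul]; exact hR)
    |>.isConnected.isPreconnected.subset_connectedComponentIn
      (F := {v | affineForm p q η v * affineForm r s ω v = R}ᶜ) hv fun w hw => ne_of_lt hw
  have hmid := hconv (hsub (show affineForm p q η x * affineForm r s ω x < R by
      rw [hx2, mul_zero]; exact hR)) (hsub (show affineForm p q η y * affineForm r s ω y < R by
      rw [hy1, zero_mul]; exact hR)) (a := 1 / 2) (b := 1 / 2) (by norm_num) (by norm_num)
      (by norm_num)
  refine connectedComponentIn_subset _ _ hmid ?_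
  rw [Set.mem_ofPred_eq, affineForm_combo p q η _ _ (by norm_num),
    affineForm_combo r s ω _ _ (by norm_num), hx1, hx2, hy1, hy2]
  nlinarith [Real.mul_self_sqrt hR.le]

/-- The closures of the convex components of the complement of a hyperbola. -/
theorem closure_convex_component (hR : 0 < R) (hd : p * s - q * r ≠ 0) {K : Set (ℝ × ℝ)}
    (hK : IsComponentOf K {v | affineForm p q η v * affineForm r s ω v = R}ᶜ)
    (hconv : Convex ℝ K) :
    closure K = branchRegion p q r s η ω R ∨
      closure K = branchRegion (-p) (-q) (-r) (-s) (-η) (-ω) R := by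
  obtain ⟨v, hv, rfl⟩ := hK
  have hne : affineForm p q η v * affineForm r s ω v ≠ R := hv
  rcases lt_or_gt_of_ne hne with h | h
  · exact absurd hconv (not_convex_middle_component hR hd h)
  rcases lt_trichotomy (affineForm p q η v) 0 with h' | h' | h'
  · right
    have := connectedComponentIn_eq_openBranchRegion (p := -p) (q := -q) (r := -r) (s := -s)
      (η := -η) (ω := -ω) hR (v := v) (by
        rw [openBranchRegion, Set.mem_ofPred_eq, affineForm_neg, affineForm_neg, neg_mul_neg]
        exact ⟨neg_pos.2 h', h⟩)
    simp only [affineForm_neg, neg_mul_neg] at this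
    rw [this, closure_openBranchRegion hR (by rwa [neg_mul_neg, neg_mul_neg])]
  · rw [h', zero_mul] at h
    exact absurd h (not_lt.2 hR.le)
  · left
    rw [connectedComponentIn_eq_openBranchRegion hR ⟨h', h⟩, closure_openBranchRegion hR hd]

end Components

/-! ### Factoring the quadratic form -/

/-- A binary quadratic form of square discriminant has a primitive linear factor. -/
theorem exists_primitive_factor {a b c Δ : ℤ} (h : Δ ^ 2 = b ^ 2 - 4 * a * c) :
    ∃ p q r s : ℤ, IsCoprime p q ∧ a = p * r ∧ b = p * s + q * r ∧ c = q * s := by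
  by_cases ha : a = 0
  · exact ⟨0, 1, b, c, isCoprime_zero_left.2 isUnit_one, by simp [ha], by simp, by simp⟩
  -- Over the rationals `2a x + (b + Δ) y` divides the form; `p x + q y` is its primitive part, and
  -- the divisibilities below are Gauss's lemma by hand.
  have hg : 0 < Int.gcd (2 * a) (b + Δ) := Int.gcd_pos_of_ne_zero_left _ (by simpa using ha)
  obtain ⟨p, q, hpq, hp, hq⟩ := Int.exists_gcd_one hg
  set g : ℤ := ((Int.gcd (2 * a) (b + Δ) : ℕ) : ℤ)
  have hg0 : g ≠ 0 := Int.natCast_ne_zero.2 hg.ne'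
  have hpq' : IsCoprime p q := Int.isCoprime_iff_gcd_eq_one.2 hpq
  have hp0 : p ≠ 0 := by
    rintro rfl
    apply ha
    linarith
  have hroot : a * q ^ 2 - b * p * q + c * p ^ 2 = 0 := by
    apply mul_left_cancel₀ (pow_ne_zero 2 hg0)
    calc g ^ 2 * (a * q ^ 2 - b * p * q + c * p ^ 2)
        = a * (q * g) ^ 2 - b * (p * g) * (q * g) + c * (p * g) ^ 2 := by ring
      _ = a * (b + Δ) ^ 2 - b * (2 * a) * (b + Δ) + c * (2 * a) ^ 2 := by rw [← hp, ← hq]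
      _ = g ^ 2 * 0 := by linear_combination a * h
  obtain ⟨r, hr⟩ : p ∣ a := by
    refine (IsCoprime.pow_right (n := 2) hpq').dvd_of_dvd_mul_right ⟨b * q - c * p, ?_⟩
    linear_combination hroot
  by_cases hq0 : q = 0
  · subst hq0
    have hpu : p * p = 1 := by
      rcases Int.isUnit_iff.1 (isCoprime_zero_right.1 hpq') with h | h <;> rw [h] <;> norm_num
    refine ⟨p, 0, r, b * p, hpq', hr, by linear_combination (-b) * hpu, ?_⟩
    linear_combination hroot - c * hpu
  · obtain ⟨s, hs⟩ : q ∣ c := by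
      refine (IsCoprime.pow_right (n := 2) hpq'.symm).dvd_of_dvd_mul_right ⟨b * p - a * q, ?_⟩
      linear_combination hroot
    refine ⟨p, q, r, s, hpq', hr, ?_, hs⟩
    apply mul_left_cancel₀ (mul_ne_zero hp0 hq0)
    rw [hr, hs] at hroot
    linear_combination (-1) * hroot

/-- The content `g` of the second factor is pulled out. The discriminant of the product is `g² (p s
- q r)²`, which gives the last identity. -/
theorem exists_factorization {a b c Δ : ℤ} (hΔ : 0 < Δ) (h : Δ ^ 2 = b ^ 2 - 4 * a * c) :
    ∃ p q r s g : ℤ, IsCoprime p q ∧ IsCoprime r s ∧ 0 < g ∧ a = g * (p * r) ∧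
      b = g * (p * s + q * r) ∧ c = g * (q * s) ∧ g * |p * s - q * r| = Δ := by
  obtain ⟨p, q, r', s', hpq, ha, hb, hc⟩ := exists_primitive_factor h
  have hg : 0 < Int.gcd r' s' := by
    rw [Nat.pos_iff_ne_zero]
    intro h0
    obtain ⟨rfl, rfl⟩ := Int.gcd_eq_zero_iff.1 h0
    have : Δ ^ 2 = 0 := by rw [h, ha, hb]; ring
    exact hΔ.ne' (pow_eq_zero_iff two_ne_zero |>.1 this)
  obtain ⟨r, s, hrs, hr, hs⟩ := Int.exists_gcd_one hg
  have hg' : (0 : ℤ) < Int.gcd r' s' := by exact_mod_cast hg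
  set g : ℤ := ((Int.gcd r' s' : ℕ) : ℤ)
  refine ⟨p, q, r, s, g, hpq, Int.isCoprime_iff_gcd_eq_one.2 hrs, hg', ?_, ?_, ?_, ?_⟩
  · rw [ha, hr]; ring
  · rw [hb, hr, hs]; ring
  · rw [hc, hs]; ring
  · rw [← abs_of_pos hg', ← abs_mul, ← abs_of_pos hΔ, ← sq_eq_sq_iff_abs_eq_abs, h, ha, hb, hc,
      hr, hs]
    ring

/-! ### Assembling the bounds -/

/-- The bounds on the number of vertices for a hyperbola given in factored form. -/
theorem vertices_bounds_of_factored {p q r s : ℤ} {η ω R m : ℝ} (hR : 0 < R) (hpq : IsCoprime p q)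
    (hrs : IsCoprime r s) (hd : p * s - q * r ≠ 0)
    (hm1 : 2 * ((|p * s - q * r| : ℤ) : ℝ) ≤ m) (hm2 : R ≤ m * ((|p * s - q * r| : ℤ) : ℝ))
    {K : Set (ℝ × ℝ)}
    (hK : IsComponentOf K {v | affineForm p q η v * affineForm r s ω v = R}ᶜ)
    (hconv : Convex ℝ K) :
    (integerHullVertices (closure K)).Finite ∧
      2 * (R / ((|p * s - q * r| : ℤ) : ℝ)) ^ ((1 : ℝ) / 3) - 2 ≤
        ((integerHullVertices (closure K)).ncard : ℝ) ∧
      ((integerHullVertices (closure K)).ncard : ℝ) ≤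
        34 * m ^ ((1 : ℝ) / 3) * (Real.logb 2 m + 2) := by
  rcases closure_convex_component hR hd hK hconv with h | h <;> rw [h]
  · obtain ⟨h1, h2⟩ := vertices_finite_and_le (η := η) (ω := ω) hpq hd hm1 hm2
    exact ⟨h1, le_ncard_vertices hpq hrs hd hR h1, h2⟩
  · have e : -p * -s - -q * -r = p * s - q * r := by ring
    rw [← e] at hd hm1 hm2 ⊢
    obtain ⟨h1, h2⟩ := vertices_finite_and_le (η := -η) (ω := -ω) hpq.neg_neg hd hm1 hm2
    exact ⟨h1, le_ncard_vertices hpq.neg_neg hrs.neg_neg hd hR h1, h2⟩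

theorem theorem1p1 :
    ∃ C : ℝ, ∀ (a b c Δ : ℤ) (n x₀ y₀ : ℝ),
      0 < Δ → (Δ : ℝ) = Real.sqrt ((b : ℝ) ^ 2 - 4 * (a : ℝ) * (c : ℝ)) → n ≠ 0 →
      ∀ K H : Set (ℝ × ℝ),
        IsComponentOf K (hyperbola (a : ℝ) (b : ℝ) (c : ℝ) n x₀ y₀)ᶜ → Convex ℝ K →
        H = closure K →
        (integerHullVertices H).Finite ∧
        2 * (|n| / (Δ : ℝ)) ^ ((1 : ℝ) / 3) - 2 ≤ ((integerHullVertices H).ncard : ℝ) ∧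
        ((integerHullVertices H).ncard : ℝ) ≤
          C * (max (2 * (Δ : ℝ)) (|n| / (Δ : ℝ))) ^ ((1 : ℝ) / 3) *
            (Real.logb 2 (max (2 * (Δ : ℝ)) (|n| / (Δ : ℝ))) + 2) := by
  refine ⟨34, ?_⟩
  rintro a b c Δ n x₀ y₀ hΔ hsqrt hn K _ hK hconv rfl
  have hΔ' : (0 : ℝ) < Δ := by exact_mod_cast hΔ
  have hdisc : Δ ^ 2 = b ^ 2 - 4 * a * c := by
    have h0 : (0 : ℝ) ≤ (b : ℝ) ^ 2 - 4 * a * c := (Real.sqrt_pos.1 (hsqrt ▸ hΔ')).le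
    have h1 : (Δ : ℝ) ^ 2 = (b : ℝ) ^ 2 - 4 * a * c := by rw [hsqrt, Real.sq_sqrt h0]
    exact_mod_cast h1
  obtain ⟨p, q, r, s, g, hpq, hrs, hg, ha, hb, hc, hgd⟩ := exists_factorization hΔ hdisc
  have hd : p * s - q * r ≠ 0 := by
    intro h
    rw [h, abs_zero, mul_zero] at hgd
    exact hΔ.ne hgd
  have hg' : (0 : ℝ) < g := by exact_mod_cast hg
  have hg1 : (1 : ℝ) ≤ g := by exact_mod_cast hg
  have hD : (0 : ℝ) < ((|p * s - q * r| : ℤ) : ℝ) := by exact_mod_cast abs_pos.2 hd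
  have hgd' : (Δ : ℝ) = g * ((|p * s - q * r| : ℤ) : ℝ) := by exact_mod_cast hgd.symm
  have hR : 0 < |n| / g := div_pos (abs_pos.2 hn) hg'
  have hRD : |n| / Δ = |n| / g / ((|p * s - q * r| : ℤ) : ℝ) := by rw [hgd', div_div]
  have hm1 : 2 * ((|p * s - q * r| : ℤ) : ℝ) ≤ max (2 * (Δ : ℝ)) (|n| / (Δ : ℝ)) := by
    refine le_trans ?_ (le_max_left _ _)
    rw [hgd']
    nlinarith
  have hm2 : |n| / g ≤ max (2 * (Δ : ℝ)) (|n| / (Δ : ℝ)) * ((|p * s - q * r| : ℤ) : ℝ) := by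
    rw [← div_le_iff₀ hD, ← hRD]
    exact le_max_right _ _
  have hhyp : hyperbola (a : ℝ) (b : ℝ) (c : ℝ) n x₀ y₀ =
      {v | affineForm p q (p * x₀ + q * y₀) v * affineForm r s (r * x₀ + s * y₀) v = n / g} := by
    ext v
    rw [hyperbola, Set.mem_ofPred_eq, Set.mem_ofPred_eq, eq_div_iff hg'.ne', ha, hb, hc]
    simp only [affineForm]
    push_cast
    constructor <;> intro h <;> rw [← h] <;> ring
  rw [hhyp] at hK
  -- For negative `n`, changing the sign of the first form makes the right side positive without
  -- affecting primitivity or `D`.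
  rcases lt_or_gt_of_ne hn with hn0 | hn0
  · have e : -p * s - -q * r = -(p * s - q * r) := by ring
    have habs : |-p * s - -q * r| = |p * s - q * r| := by rw [e, abs_neg]
    have hset : {v | affineForm p q (p * x₀ + q * y₀) v *
        affineForm r s (r * x₀ + s * y₀) v = n / g} =
        {v | affineForm (-p) (-q) (-(p * x₀ + q * y₀)) v *
          affineForm r s (r * x₀ + s * y₀) v = |n| / g} := by
      ext v
      rw [Set.mem_ofPred_eq, Set.mem_ofPred_eq, affineForm_neg, abs_of_neg hn0, neg_div, neg_mul,
        neg_inj]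
    rw [hset] at hK
    have h := vertices_bounds_of_factored
      (m := max (2 * (Δ : ℝ)) (|n| / (Δ : ℝ))) hR hpq.neg_neg hrs
      (by rw [e]; exact neg_ne_zero.2 hd) (by rwa [habs]) (by rwa [habs]) hK hconv
    rw [habs, ← hRD] at h
    exact h
  · rw [← abs_of_pos hn0] at hK
    have h := vertices_bounds_of_factored hR hpq hrs hd hm1 hm2 hK hconv
    rw [← hRD] at h
    exact h
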